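/- Let $\mathrm{Ai}$ and $\mathrm{Gi}$ denote the entire functions which for real $x$ are given by the convergent improper integrals $$\mathrm{Ai}(x)=\frac1\pi\int_0^\infty\cos\left(xt+\tfrac13t^3\right)dt,\qquad \mathrm{Gi}(x)=\frac1\pi\int_0^\infty\sin\left(xt+\tfrac13t^3\right)dt .$$ Let $z=x+iy$ satisfy $0\le\mathrm{ph}\,z\le\frac23\pi$ (the value $z=0$ is allowed), and put $\psi(t)=zt+\frac13t^3$ and $\psi(u+iv)=\psi_r(u,v)+i\psi_i(u,v)$ for real $u,v$. For $u>0$ let $$v(u)=\frac{-y+\sqrt{y^2+4u^2\left(x+\frac13u^2\right)}}{2u},\qquad g(u)=1+i\,\frac{dv}{du}(u).$$ Then the following hold. 1. For every $u>0$ the number under the square root is non-negative, and $\psi_r(u,v(u))=0$. 2. For every $u>0$ (except for the single point $u=\sqrt{-3x/2}$ when $\mathrm{ph}\,z=\frac23\pi$ and $z\neq0$), $2uv+y>0$ and $v$ is differentiable at $u$ with $$\frac{dv}{du}=\frac{u^2-v^2+x}{2uv+y},\qquad v=v(u).$$ 3. The function $e^{-\psi_i(u,v(u))}g(u)$ is absolutely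 integrable on $(0,\infty)$. 4. If $0<\mathrm{ph}\,z\le\frac23\pi$, or $z=0$, then $$\mathrm{Gi}(z)=\frac1{\pi i}\int_0^\infty e^{-\psi_i(u,v(u))}\,g(u)\,du+i\,\mathrm{Ai}(z).$$ 5. If $\mathrm{ph}\,z=0$ and $z=x>0$, the curve $v=v(u)$ starts at $i\sqrt x$ instead of at the origin, and the segment from $0$ to $i\sqrt x$ (on which also $\psi_r=0$) has to be added to the path: $$\mathrm{Gi}(x)=\frac1{\pi i}\left[\int_0^{\sqrt x}e^{-\psi_i(0,v)}\,i\,dv+\int_0^\infty e^{-\psi_i(u,v(u))}\,g(u)\,du\right]+i\,\mathrm{Ai}(x).$$ -/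

import Mathlib

open Filter Topology MeasureTheory Set

/-- The phase `ψ(t) = z t + t³ / 3`. -/
noncomputable def psi (z t : ℂ) : ℂ := z * t + t ^ 3 / 3

/-- `ψ_r(u, v)`, the real part of `ψ` at `t = u + i v`. -/
noncomputable def psiRe (z : ℂ) (u v : ℝ) : ℝ := (psi z ((u : ℂ) + (v : ℂ) * Complex.I)).re

/-- `ψ_i(u, v)`, the imaginary part of `ψ` at `t = u + i v`. -/
noncomputable def psiIm (z : ℂ) (u v : ℝ) : ℝ := (psi z ((u : ℂ) + (v : ℂ) * Complex.I)).im

/-- The path `v = v(u)`, with `z = x + i y`: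
`v = (-y + √(y² + 4 u² (x + u² / 3))) / (2 u)` for `u > 0`. -/
noncomputable def pathV (z : ℂ) (u : ℝ) : ℝ :=
  (-z.im + Real.sqrt (z.im ^ 2 + 4 * u ^ 2 * (z.re + u ^ 2 / 3))) / (2 * u)

/-- `g(u) = 1 + i dv/du` along the path. -/
noncomputable def pathG (z : ℂ) (u : ℝ) : ℂ := 1 + Complex.I * ((deriv (pathV z) u : ℝ) : ℂ)

/-- `f` is entire and, on the real axis, it is the (conditionally convergent) improper integral
`f(x) = (1/π) ∫₀^∞ cos (x t + t³ / 3) dt`. -/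
def IsAiryAi (f : ℂ → ℂ) : Prop :=
  Differentiable ℂ f ∧ ∀ x : ℝ, Tendsto
    (fun T : ℝ => (((1 / Real.pi) * ∫ t in (0 : ℝ)..T, Real.cos (x * t + t ^ 3 / 3) : ℝ) : ℂ))
    atTop (𝓝 (f x))

/-- `f` is entire and, on the real axis, it is the (conditionally convergent) improper integral
`f(x) = (1/π) ∫₀^∞ sin (x t + t³ / 3) dt`. -/
def IsScorerGi (f : ℂ → ℂ) : Prop :=
  Differentiable ℂ f ∧ ∀ x : ℝ, Tendsto
    (fun T : ℝ => (((1 / Real.pi) * ∫ t in (0 : ℝ)..T, Real.sin (x * t + t ^ 3 / 3) : ℝ) : ℂ))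
    atTop (𝓝 (f x))

/-! Existence and uniqueness of these two entire functions. -/

theorem differentiable_integral_exp_psi {μ : Measure ℝ} {γ : ℝ → ℂ} (hγ : Continuous γ)
    (hint : ∀ R : ℝ, Integrable (fun u => Real.exp (R * ‖γ u‖ - (γ u ^ 3).im / 3)) μ) :
    Differentiable ℂ (fun z => ∫ u, Complex.exp (Complex.I * psi z (γ u)) ∂μ) := by
  have hnorm : ∀ z u, ‖Complex.exp (Complex.I * psi z (γ u))‖
      ≤ Real.exp (‖z‖ * ‖γ u‖ - (γ u ^ 3).im / 3) := by
    intro z u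
    rw [Complex.norm_exp]
    apply Real.exp_le_exp.2
    have h1 : (Complex.I * psi z (γ u)).re = -(z * γ u).im - (γ u ^ 3).im / 3 := by
      have h3 : (γ u ^ 3 / 3).im = (γ u ^ 3).im / 3 := by
        rw [show (3 : ℂ) = ((3 : ℝ) : ℂ) by norm_num, Complex.div_ofReal_im]
      rw [Complex.I_mul_re, psi, Complex.add_im, h3]
      ring
    have h2 := (abs_le.1 (Complex.abs_im_le_norm (z * γ u))).1
    rw [norm_mul] at h2
    linarith
  have hcont : ∀ z, Continuous (fun u => Complex.exp (Complex.I * psi z (γ u))) := by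
    intro z
    unfold psi
    fun_prop
  intro z₀
  refine (hasDerivAt_integral_of_dominated_loc_of_deriv_le (μ := μ)
    (F := fun z u => Complex.exp (Complex.I * psi z (γ u)))
    (F' := fun z u => Complex.exp (Complex.I * psi z (γ u)) * (Complex.I * γ u))
    (bound := fun u => Real.exp ((‖z₀‖ + 2) * ‖γ u‖ - (γ u ^ 3).im / 3))
    (Metric.ball_mem_nhds z₀ one_pos) ?_ ?_ ?_ ?_ (hint _) ?_).2.differentiableAt
  · exact Eventually.of_forall fun z => (hcont z).aestronglyMeasurable
  · exact (hint ‖z₀‖).mono' (hcont z₀).aestronglyMeasurable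
      (Eventually.of_forall fun u => hnorm z₀ u)
  · exact ((hcont z₀).mul (by fun_prop)).aestronglyMeasurable
  · refine Eventually.of_forall fun u z hz => ?_
    have hz' : ‖z‖ ≤ ‖z₀‖ + 1 := by
      have := norm_le_norm_add_norm_sub' z z₀
      rw [Metric.mem_ball, dist_eq_norm] at hz
      linarith
    rw [norm_mul, norm_mul, Complex.norm_I, one_mul]
    have h4 : ‖γ u‖ ≤ Real.exp ‖γ u‖ := by
      have := Real.add_one_le_exp ‖γ u‖
      linarith
    calc _ ≤ Real.exp (‖z‖ * ‖γ u‖ - (γ u ^ 3).im / 3) * Real.exp ‖γ u‖ :=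
          mul_le_mul (hnorm z u) h4 (norm_nonneg _) (Real.exp_nonneg _)
      _ = Real.exp ((‖z‖ + 1) * ‖γ u‖ - (γ u ^ 3).im / 3) := by
          rw [← Real.exp_add]; ring_nf
      _ ≤ _ := by
          apply Real.exp_le_exp.2
          have := mul_le_mul_of_nonneg_right hz' (norm_nonneg (γ u))
          nlinarith
  · refine Eventually.of_forall fun u z _ => ?_
    have h5 : HasDerivAt (fun z => Complex.I * psi z (γ u)) (Complex.I * γ u) z := by
      unfold psi
      simpa using (((hasDerivAt_id z).mul_const (γ u)).add_const (γ u ^ 3 / 3)).const_mul Complex.I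
    exact h5.cexp

theorem integrable_exp_shift (R : ℝ) :
    Integrable (fun u : ℝ => Real.exp (R * ‖(u : ℂ) + Complex.I‖
      - (((u : ℂ) + Complex.I) ^ 3).im / 3)) := by
  have key : ∀ c : ℝ, Integrable (fun u : ℝ => Real.exp (-u ^ 2 + c * u + (|R| + 1))) := by
    intro c
    have h := (integrable_cexp_quadratic' (b := -1) (by simp) (c : ℂ) ((|R| + 1 : ℝ) : ℂ)).norm
    refine h.congr (Eventually.of_forall fun u => ?_)
    simp only [Complex.norm_exp]
    congr 1
    have : (-1 * (u : ℂ) ^ 2 + c * u + ((|R| + 1 : ℝ) : ℂ))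
        = ((-u ^ 2 + c * u + (|R| + 1) : ℝ) : ℂ) := by push_cast; ring
    rw [this, Complex.ofReal_re]
  refine ((key |R|).add (key (-|R|))).mono' (by fun_prop) (Eventually.of_forall fun u => ?_)
  rw [Real.norm_of_nonneg (Real.exp_nonneg _)]
  have him : (((u : ℂ) + Complex.I) ^ 3).im = 3 * u ^ 2 - 1 := by
    simp [pow_succ]; ring
  have hn : ‖(u : ℂ) + Complex.I‖ ≤ |u| + 1 := by
    have := norm_add_le (u : ℂ) Complex.I
    simpa using this
  have h1 : R * ‖(u : ℂ) + Complex.I‖ ≤ |R| * (|u| + 1) :=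
    (mul_le_mul_of_nonneg_right (le_abs_self R) (norm_nonneg _)).trans
      (mul_le_mul_of_nonneg_left hn (abs_nonneg R))
  rw [him]
  simp only [Pi.add_apply]
  rcases abs_cases u with ⟨h, _⟩ | ⟨h, _⟩
  · refine le_trans (Real.exp_le_exp.2 ?_) (le_add_of_nonneg_right (Real.exp_nonneg _))
    rw [h] at h1; linarith
  · refine le_trans (Real.exp_le_exp.2 ?_) (le_add_of_nonneg_left (Real.exp_nonneg _))
    rw [h] at h1; linarith

/-- There is an entire function that equals the improper integral `∫₀^∞ exp (i (x t + t³/3)) dt`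
on the real axis. -/
theorem exists_entire_exp_psi : ∃ P : ℂ → ℂ, Differentiable ℂ P ∧ ∀ x : ℝ, Tendsto
    (fun T : ℝ => ∫ t in (0 : ℝ)..T, Complex.exp (Complex.I * psi x t)) atTop (𝓝 (P x)) := by
  have hc : ∀ z : ℂ, Continuous (fun t => Complex.exp (Complex.I * psi z t)) := by
    intro z; unfold psi; fun_prop
  refine ⟨fun z => (∫ u in Ioi (0 : ℝ), Complex.exp (Complex.I * psi z ((u : ℂ) + Complex.I)))
    + Complex.I * ∫ v in Ioc (0 : ℝ) 1, Complex.exp (Complex.I * psi z ((v : ℂ) * Complex.I)),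
    ?_, ?_⟩
  · refine Differentiable.add ?_ (Differentiable.const_mul ?_ _)
    · exact differentiable_integral_exp_psi (γ := fun u : ℝ => (u : ℂ) + Complex.I) (by fun_prop)
        fun R => (integrable_exp_shift R).integrableOn
    · refine differentiable_integral_exp_psi (γ := fun v : ℝ => (v : ℂ) * Complex.I)
        (by fun_prop) fun R => ?_
      exact (Continuous.integrableOn_Icc (by fun_prop)).mono_set Ioc_subset_Icc_self
  · intro x
    have hrect : ∀ T : ℝ, ∫ t in (0 : ℝ)..T, Complex.exp (Complex.I * psi x t)
        = (∫ u in (0 : ℝ)..T, Complex.exp (Complex.I * psi x ((u : ℂ) + Complex.I)))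
        + Complex.I * (∫ v in (0 : ℝ)..1, Complex.exp (Complex.I * psi x ((v : ℂ) * Complex.I)))
        - Complex.I * ∫ v in (0 : ℝ)..1,
            Complex.exp (Complex.I * psi x ((T : ℂ) + (v : ℂ) * Complex.I)) := by
      intro T
      have hd : Differentiable ℂ (fun t => Complex.exp (Complex.I * psi x t)) := by
        unfold psi; fun_prop
      have h := Complex.integral_boundary_rect_eq_zero_of_differentiableOn
        (fun t => Complex.exp (Complex.I * psi x t)) 0 ((T : ℂ) + Complex.I) hd.differentiableOn
      simp at h
      linear_combination h
    simp_rw [hrect]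
    have h1 : Tendsto (fun T : ℝ => ∫ u in (0 : ℝ)..T,
        Complex.exp (Complex.I * psi x ((u : ℂ) + Complex.I))) atTop
        (𝓝 (∫ u in Ioi (0 : ℝ), Complex.exp (Complex.I * psi x ((u : ℂ) + Complex.I)))) := by
      refine intervalIntegral_tendsto_integral_Ioi 0 ?_ tendsto_id
      refine Integrable.integrableOn ?_
      refine (integrable_exp_shift |x|).mono'
        ((hc x).comp (by fun_prop : Continuous fun u : ℝ => (u : ℂ) + Complex.I)).aestronglyMeasurable
        (Eventually.of_forall fun u => ?_)
      rw [Complex.norm_exp]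
      apply Real.exp_le_exp.2
      have him : (((u : ℂ) + Complex.I) ^ 3).im = 3 * u ^ 2 - 1 := by
        simp [pow_succ]; ring
      have him' : (Complex.I * psi x ((u : ℂ) + Complex.I)).re = -x - (3 * u ^ 2 - 1) / 3 := by
        rw [Complex.I_mul_re, psi, Complex.add_im, show (3 : ℂ) = ((3 : ℝ) : ℂ) by norm_num,
          Complex.div_ofReal_im, him]
        simp
        ring
      have hn : 1 ≤ ‖(u : ℂ) + Complex.I‖ := by
        simpa using Complex.abs_im_le_norm ((u : ℂ) + Complex.I)
      rw [him, him']
      have := neg_abs_le x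
      nlinarith [abs_nonneg x]
    have h2 : Tendsto (fun T : ℝ => ∫ v in (0 : ℝ)..1,
        Complex.exp (Complex.I * psi x ((T : ℂ) + (v : ℂ) * Complex.I))) atTop (𝓝 0) := by
      have h0 : (0 : ℂ) = ∫ v in (0 : ℝ)..1, (0 : ℂ) := by simp
      have hre : ∀ T v : ℝ, (Complex.I * psi x ((T : ℂ) + (v : ℂ) * Complex.I)).re
          = -(x * v) + v ^ 3 / 3 - T ^ 2 * v := by
        intro T v
        have him : (((T : ℂ) + (v : ℂ) * Complex.I) ^ 3).im = 3 * T ^ 2 * v - v ^ 3 := by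
          simp [pow_succ]; ring
        rw [Complex.I_mul_re, psi, Complex.add_im, show (3 : ℂ) = ((3 : ℝ) : ℂ) by norm_num,
          Complex.div_ofReal_im, him]
        simp
        ring
      rw [h0]
      refine intervalIntegral.tendsto_integral_filter_of_dominated_convergence
        (fun _ => Real.exp (|x| + 1)) (Eventually.of_forall fun T => ?_)
        (Eventually.of_forall fun T => Eventually.of_forall fun v hv => ?_)
        (by simp) (Eventually.of_forall fun v hv => ?_)
      · exact ((hc x).comp
          (by fun_prop : Continuous fun v : ℝ => (T : ℂ) + (v : ℂ) * Complex.I)).aestronglyMeasurable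
      · rw [uIoc_of_le zero_le_one] at hv
        rw [Complex.norm_exp, hre]
        apply Real.exp_le_exp.2
        have h3 : v ^ 3 ≤ 1 := pow_le_one₀ hv.1.le hv.2
        have h4 : -(x * v) ≤ |x| := by
          have := neg_abs_le x
          nlinarith [abs_nonneg x, hv.1, hv.2]
        have h5 : 0 ≤ T ^ 2 * v := mul_nonneg (sq_nonneg T) hv.1.le
        linarith
      · rw [uIoc_of_le zero_le_one] at hv
        rw [tendsto_zero_iff_norm_tendsto_zero]
        simp_rw [Complex.norm_exp, hre]
        refine Real.tendsto_exp_atBot.comp ?_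
        simp_rw [sub_eq_add_neg]
        refine tendsto_atBot_add_const_left _ _ (tendsto_neg_atTop_atBot.comp ?_)
        exact (tendsto_pow_atTop two_ne_zero).atTop_mul_const hv.1
    have h := (h1.add_const (Complex.I * (∫ v in (0 : ℝ)..1,
      Complex.exp (Complex.I * psi x ((v : ℂ) * Complex.I))))).sub (h2.const_mul Complex.I)
    simpa [intervalIntegral.integral_of_le] using h

theorem entire_eq_of_eq_on_real {f g : ℂ → ℂ} (hf : Differentiable ℂ f) (hg : Differentiable ℂ g)
    (h : ∀ x : ℝ, f x = g x) : f = g := by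
  refine AnalyticOnNhd.eq_of_frequently_eq (𝕜 := ℂ) (z₀ := 0)
    (fun z _ => hf.analyticAt z) (fun z _ => hg.analyticAt z) ?_
  have ht : Tendsto (fun x : ℝ => (x : ℂ)) (𝓝[≠] 0) (𝓝[≠] 0) := by
    refine tendsto_nhdsWithin_of_tendsto_nhds_of_eventually_within _ ?_ ?_
    · exact (Complex.continuous_ofReal.tendsto' 0 0 (by simp)).mono_left nhdsWithin_le_nhds
    · filter_upwards [self_mem_nhdsWithin] with x hx
      simpa using hx
  exact ht.frequently (Frequently.of_forall h)

theorem exp_psi_real (x t : ℝ) : Complex.exp (Complex.I * psi x t)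
    = (Real.cos (x * t + t ^ 3 / 3) : ℂ) + (Real.sin (x * t + t ^ 3 / 3) : ℂ) * Complex.I := by
  rw [psi, mul_comm Complex.I, Complex.exp_mul_I]
  push_cast
  rfl

theorem exists_isAiryAi_isScorerGi : (∃ f, IsAiryAi f) ∧ ∃ f, IsScorerGi f := by
  obtain ⟨P, hP, hlim⟩ := exists_entire_exp_psi
  have hP' : Differentiable ℂ (fun z => (starRingEnd ℂ) (P ((starRingEnd ℂ) z))) :=
    fun z => by simpa [Function.comp_def] using (hP ((starRingEnd ℂ) z)).conj_conj
  have hI : ∀ x T : ℝ, ∫ t in (0 : ℝ)..T, Complex.exp (Complex.I * psi x t)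
      = ((∫ t in (0 : ℝ)..T, Real.cos (x * t + t ^ 3 / 3) : ℝ) : ℂ)
        + ((∫ t in (0 : ℝ)..T, Real.sin (x * t + t ^ 3 / 3) : ℝ) : ℂ) * Complex.I := by
    intro x T
    simp_rw [exp_psi_real]
    rw [intervalIntegral.integral_add, intervalIntegral.integral_mul_const,
      intervalIntegral.integral_ofReal, intervalIntegral.integral_ofReal]
    · exact Continuous.intervalIntegrable (by fun_prop) _ _
    · exact Continuous.intervalIntegrable (by fun_prop) _ _
  have hre : ∀ x : ℝ, Tendsto (fun T : ℝ => ∫ t in (0 : ℝ)..T, Real.cos (x * t + t ^ 3 / 3))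
      atTop (𝓝 (P x).re) := by
    intro x
    have := (Complex.continuous_re.tendsto _).comp (hlim x)
    refine this.congr fun T => ?_
    simp only [Function.comp_apply, hI]
    simp
  have him : ∀ x : ℝ, Tendsto (fun T : ℝ => ∫ t in (0 : ℝ)..T, Real.sin (x * t + t ^ 3 / 3))
      atTop (𝓝 (P x).im) := by
    intro x
    have := (Complex.continuous_im.tendsto _).comp (hlim x)
    refine this.congr fun T => ?_
    simp only [Function.comp_apply, hI]
    simp
  refine ⟨⟨fun z => (1 / Real.pi) * ((P z + (starRingEnd ℂ) (P ((starRingEnd ℂ) z))) / 2),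
      ((hP.add hP').div_const _).const_mul _, fun x => ?_⟩,
    ⟨fun z => (1 / Real.pi) * ((P z - (starRingEnd ℂ) (P ((starRingEnd ℂ) z))) / (2 * Complex.I)),
      ((hP.sub hP').div_const _).const_mul _, fun x => ?_⟩⟩
  · have h := (Complex.continuous_ofReal.tendsto _).comp ((hre x).const_mul (1 / Real.pi))
    simp only [Complex.conj_ofReal, ← Complex.re_eq_add_conj]
    simpa [Function.comp_def] using h
  · have h := (Complex.continuous_ofReal.tendsto _).comp ((him x).const_mul (1 / Real.pi))
    simp only [Complex.conj_ofReal, ← Complex.im_eq_sub_conj]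
    simpa [Function.comp_def] using h

theorem isAiryAi_unique {f g : ℂ → ℂ} (hf : IsAiryAi f) (hg : IsAiryAi g) : f = g :=
  entire_eq_of_eq_on_real hf.1 hg.1 fun x => tendsto_nhds_unique (hf.2 x) (hg.2 x)

theorem isScorerGi_unique {f g : ℂ → ℂ} (hf : IsScorerGi f) (hg : IsScorerGi g) : f = g :=
  entire_eq_of_eq_on_real hf.1 hg.1 fun x => tendsto_nhds_unique (hf.2 x) (hg.2 x)

/-- The Airy function `Ai`: the unique function with `IsAiryAi`. -/
noncomputable def airyAi : ℂ → ℂ := Classical.choose exists_isAiryAi_isScorerGi.1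

/-- The Scorer function `Gi`: the unique function with `IsScorerGi`. -/
noncomputable def scorerGi : ℂ → ℂ := Classical.choose exists_isAiryAi_isScorerGi.2

theorem isAiryAi_airyAi : IsAiryAi airyAi := Classical.choose_spec exists_isAiryAi_isScorerGi.1

theorem isScorerGi_scorerGi : IsScorerGi scorerGi :=
  Classical.choose_spec exists_isAiryAi_isScorerGi.2

/-! Where `ψ_r = 0` one has `exp (iψ) = exp (-ψ_i)`, so the integrand `exp (-ψ_i) g du` is `exp
(iψ(t)) dt` along the path. Since `exp (iψ)` is entire it has a primitive `Φ` with `Φ 0 = 0`, and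
the path integral is the limit of `Φ` at the far end minus its value at the start, `0` or `i√x`
(`integral_pathG_eq`). The far limit is the same along the path, the diagonal `u + iu` and the real
axis, because vertical segments between heights `0` and `u` contribute `O(u⁻²)`
(`norm_primitive_vertical_le`). On the diagonal the integral converges absolutely for every `z` and
is entire in `z`. For real `z` it equals `π (Ai + i Gi)` by comparison with the real axis, hence for
all `z` (`airyAi_add_I_mul_scorerGi`). Integrability needs `dv/du` bounded and `ψ_i` at least `u`
for large `u`. All estimates use the sector in the form `0 ≤ y`, `0 ≤ √3 x + y`. -/

/-! ### The discriminant and the equation of the path. -/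

/-- The discriminant of the quadratic equation for `v` at a given `u`. -/
noncomputable def pathDisc (z : ℂ) (u : ℝ) : ℝ := z.im ^ 2 + 4 * u ^ 2 * (z.re + u ^ 2 / 3)

theorem psiRe_eq (z : ℂ) (u v : ℝ) :
    psiRe z u v = u * z.re - v * z.im + u ^ 3 / 3 - u * v ^ 2 := by
  have h3 : (3 : ℂ) = ((3 : ℝ) : ℂ) := by norm_num
  rw [psiRe, psi, Complex.add_re, h3, Complex.div_ofReal_re]
  simp [pow_succ]
  ring

theorem psiIm_eq (z : ℂ) (u v : ℝ) :
    psiIm z u v = z.re * v + z.im * u + u ^ 2 * v - v ^ 3 / 3 := by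
  have h3 : (3 : ℂ) = ((3 : ℝ) : ℂ) := by norm_num
  rw [psiIm, psi, Complex.add_im, h3, Complex.div_ofReal_im]
  simp [pow_succ]
  ring

theorem pathDisc_eq (z : ℂ) (u : ℝ) : pathDisc z u
    = 4 / 3 * (u ^ 2 + 3 / 2 * z.re) ^ 2 + (z.im ^ 2 - 3 * z.re ^ 2) := by
  rw [pathDisc]; ring

/-- In a sector `0 ≤ y`, `0 ≤ √3 x + y`, the negative real parts are dominated. -/
theorem three_mul_re_sq_le {z : ℂ} (hs : 0 ≤ √3 * z.re + z.im) (hx : z.re ≤ 0) :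
    3 * z.re ^ 2 ≤ z.im ^ 2 := by
  have h3 : √3 ^ 2 = 3 := Real.sq_sqrt (by norm_num)
  have : 0 ≤ √3 := Real.sqrt_nonneg 3
  nlinarith [mul_nonneg this (neg_nonneg.2 hx)]

theorem pathDisc_nonneg {z : ℂ} (hs : 0 ≤ √3 * z.re + z.im) (u : ℝ) : 0 ≤ pathDisc z u := by
  rcases le_total z.re 0 with hx | hx
  · rw [pathDisc_eq]
    have := three_mul_re_sq_le hs hx
    nlinarith [sq_nonneg (u ^ 2 + 3 / 2 * z.re)]
  · rw [pathDisc]; positivity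

/-- For `x ≤ 0` a zero makes both nonnegative terms of `pathDisc_eq` vanish: the square fixes `u`,
and `y² = 3x²` puts `z` on the boundary ray of the sector. The excluded point is the saddle `ψ' =
0`, where the path has a corner. -/
theorem pathDisc_pos {z : ℂ} (hs : 0 ≤ √3 * z.re + z.im) {u : ℝ} (hu : 0 < u)
    (hne : ¬ (√3 * z.re + z.im = 0 ∧ 2 * u ^ 2 = -3 * z.re)) : 0 < pathDisc z u := by
  rcases le_total 0 z.re with hx | hx
  · rw [pathDisc]; positivity
  · refine lt_of_le_of_ne (pathDisc_nonneg hs u) fun h => hne ?_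
    have h1 := three_mul_re_sq_le hs hx
    rw [pathDisc_eq] at h
    have h2 : u ^ 2 + 3 / 2 * z.re = 0 := by
      have : (u ^ 2 + 3 / 2 * z.re) ^ 2 = 0 :=
        le_antisymm (by linarith) (sq_nonneg _)
      exact pow_eq_zero_iff two_ne_zero |>.1 this
    refine ⟨?_, by linarith⟩
    have h3 : √3 ^ 2 = 3 := Real.sq_sqrt (by norm_num)
    have h4 : (√3 * z.re + z.im) * (z.im - √3 * z.re) = 0 := by nlinarith
    rcases mul_eq_zero.1 h4 with h5 | h5
    · exact h5
    · have : 0 ≤ √3 * -z.re := mul_nonneg (Real.sqrt_nonneg 3) (by linarith)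
      nlinarith

theorem two_mul_mul_pathV_add (z : ℂ) {u : ℝ} (hu : 0 < u) :
    2 * u * pathV z u + z.im = √(pathDisc z u) := by
  rw [pathV, pathDisc]; field_simp; ring

theorem pathV_quadratic {z : ℂ} (hs : 0 ≤ √3 * z.re + z.im) {u : ℝ} (hu : 0 < u) :
    u * pathV z u ^ 2 + z.im * pathV z u = u * (z.re + u ^ 2 / 3) := by
  have h := Real.sq_sqrt (pathDisc_nonneg hs u)
  rw [← two_mul_mul_pathV_add z hu, pathDisc] at h
  have : 4 * u * (u * pathV z u ^ 2 + z.im * pathV z u - u * (z.re + u ^ 2 / 3)) = 0 := by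
    linarith
  have := (mul_eq_zero.1 this).resolve_left (by positivity)
  linarith

theorem psiRe_pathV {z : ℂ} (hs : 0 ≤ √3 * z.re + z.im) {u : ℝ} (hu : 0 < u) :
    psiRe z u (pathV z u) = 0 := by
  rw [psiRe_eq]
  linarith [pathV_quadratic hs hu]

theorem pathV_eq_div (z : ℂ) (u : ℝ) : pathV z u = (-z.im + √(pathDisc z u)) / (2 * u) := rfl

theorem hasDerivAt_pathV {z : ℂ} {u : ℝ} (hu : 0 < u) (hD : 0 < pathDisc z u) :
    HasDerivAt (pathV z)
      ((u ^ 2 - pathV z u ^ 2 + z.re) / (2 * u * pathV z u + z.im)) u := by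
  have hd : HasDerivAt (pathDisc z) (4 * (2 * u) * (z.re + u ^ 2 / 3) + 4 * u ^ 2 * (2 * u / 3)) u := by
    unfold pathDisc
    have h2 : HasDerivAt (fun u : ℝ => u ^ 2) (2 * u) u := by simpa using hasDerivAt_pow 2 u
    exact ((h2.const_mul 4).mul ((h2.div_const 3).const_add z.re)).const_add _
  have h := ((hd.sqrt hD.ne').const_add (-z.im)).div ((hasDerivAt_id u).const_mul 2)
    (by simpa using hu.ne')
  refine h.congr_deriv ?_
  rw [two_mul_mul_pathV_add z hu, pathV_eq_div]
  have hs := Real.sq_sqrt hD.le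
  have hp := Real.sqrt_pos.2 hD
  set s := √(pathDisc z u)
  rw [pathDisc] at hs
  simp only [id]
  field_simp
  ring_nf
  ring_nf at hs
  linear_combination (-3) * hs

theorem continuousOn_pathV (z : ℂ) : ContinuousOn (pathV z) (Ioi 0) := by
  unfold pathV
  refine ContinuousOn.div (by fun_prop) (by fun_prop) fun u hu => ?_
  have : 0 < u := hu
  positivity

/-! ### The fundamental theorem of calculus on a half-line with exceptional points. -/

/-- Needed because the path may have a corner and `pathV` is only controlled on `u > 0`. The
half-line is exhausted by the intervals from `a + 1/b` to `a + b`. -/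
theorem integral_Ioi_of_hasDerivAt_off_countable {E : Type*} [NormedAddCommGroup E]
    [NormedSpace ℝ E] [CompleteSpace E] {f f' : ℝ → E} {a : ℝ} {l m : E} {s : Set ℝ}
    (hs : s.Countable) (hc : ContinuousOn f (Ioi a))
    (hd : ∀ x ∈ Ioi a \ s, HasDerivAt f (f' x) x) (hi : IntegrableOn f' (Ioi a))
    (ha : Tendsto f (𝓝[>] a) (𝓝 m)) (hb : Tendsto f atTop (𝓝 l)) :
    ∫ x in Ioi a, f' x = l - m := by
  have hinv : Tendsto (fun b : ℝ => a + b⁻¹) atTop (𝓝[>] a) := by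
    refine tendsto_nhdsWithin_of_tendsto_nhds_of_eventually_within _ ?_ ?_
    · simpa using tendsto_inv_atTop_zero.const_add a
    · filter_upwards [eventually_gt_atTop 0] with b hb
      simpa using hb
  have hcov : AECover (volume.restrict (Ioi a)) (atTop : Filter ℝ)
      (fun b : ℝ => Ioc (a + b⁻¹) (a + b)) := by
    have h1 := aecover_Ioi_of_Ioi (μ := volume) (hinv.mono_right nhdsWithin_le_nhds)
    have h2 := (aecover_Iic (μ := volume)
      (tendsto_atTop_add_const_left atTop a tendsto_id)).restrict (s := Ioi a)
    exact h1.inter h2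
  have h1 := hcov.integral_tendsto_of_countably_generated hi
  refine tendsto_nhds_unique h1 ?_
  have h2 : Tendsto (fun b : ℝ => f (a + b) - f (a + b⁻¹)) atTop (𝓝 (l - m)) :=
    (hb.comp (tendsto_atTop_add_const_left atTop a tendsto_id)).sub (ha.comp hinv)
  refine h2.congr' ?_
  filter_upwards [eventually_gt_atTop 1] with b hb1
  have hb0 : 0 < b⁻¹ := by positivity
  have hle : b⁻¹ ≤ b := by
    have := inv_lt_one_of_one_lt₀ hb1
    linarith
  have hsub : Icc (a + b⁻¹) (a + b) ⊆ Ioi a := fun x hx => by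
    have := hx.1
    simp only [mem_Ioi]; linarith
  have hIoc : Ioc (a + b⁻¹) (a + b) ⊆ Ioi a := Ioc_subset_Icc_self.trans hsub
  rw [Measure.restrict_restrict measurableSet_Ioc, inter_eq_self_of_subset_left hIoc,
    ← intervalIntegral.integral_of_le (by linarith)]
  symm
  refine integral_eq_of_hasDerivAt_off_countable_of_le f f' (by linarith) hs (hc.mono hsub)
    (fun x hx => hd x ⟨hsub (Ioo_subset_Icc_self hx.1), hx.2⟩) ?_
  rw [intervalIntegrable_iff_integrableOn_Ioc_of_le (by linarith)]
  exact hi.mono_set hIoc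

/-! ### Boundedness of `dv/du`. -/

/-- The rationalised root: it removes the division by `u`, which settles the limit at `u = 0` when
`y > 0` and the sign of `v`. -/
theorem pathV_mul_add_sqrt {z : ℂ} (hs : 0 ≤ √3 * z.re + z.im) {u : ℝ} (hu : 0 < u) :
    pathV z u * (z.im + √(pathDisc z u)) = 2 * u * (z.re + u ^ 2 / 3) := by
  have h := pathV_quadratic hs hu
  rw [← two_mul_mul_pathV_add z hu]
  linear_combination 2 * h

/-- The numerator of `dv/du`, after elimination of `v`. -/
theorem pathV_deriv_num {z : ℂ} (hs : 0 ≤ √3 * z.re + z.im) {u : ℝ} (hu : 0 < u) :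
    (u ^ 2 - pathV z u ^ 2 + z.re) * (z.im + √(pathDisc z u))
      = 2 / 3 * u ^ 2 * (z.im + √(pathDisc z u)) + 2 * z.im * (z.re + u ^ 2 / 3) := by
  have h := pathV_quadratic hs hu
  have h2 := pathV_mul_add_sqrt hs hu
  refine mul_left_cancel₀ hu.ne' ?_
  linear_combination (-(z.im + √(pathDisc z u))) * h + z.im * h2

/-- Here and in the next two lemmas `w = u²`, `D = √(pathDisc z u)` and `N` is the numerator of
`dv/du`, so the factor of `D` bounds `|dv/du|`. The bound rests on `w ≤ D` and `y ≤ D`. -/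
theorem abs_le_mul_of_re_nonneg {x y w D N : ℝ} (hx : 0 ≤ x) (hy : 0 ≤ y) (hw : 0 < w) (hD : 0 < D)
    (hD2 : D ^ 2 = y ^ 2 + 4 * w * (x + w / 3))
    (hN : N * (y + D) = 2 / 3 * w * (y + D) + 2 * y * (x + w / 3)) :
    |N| ≤ (4 / 3 + x / y) * D := by
  have h1 : w ≤ D := by
    refine abs_le_of_sq_le_sq' ?_ hD.le |>.2
    nlinarith [mul_nonneg hw.le hx]
  have hN0 : 0 ≤ N := by
    have : 0 ≤ N * (y + D) := by rw [hN]; positivity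
    exact nonneg_of_mul_nonneg_left this (by linarith)
  rw [abs_of_nonneg hN0]
  rcases hy.eq_or_lt with rfl | hy
  · have : N * D = 2 / 3 * w * D := by simpa using hN
    have := mul_right_cancel₀ hD.ne' this
    -- For `y = 0` the convention `x / 0 = 0` is harmless: the term it should control has the factor
    -- `y`.
    simp only [div_zero]
    linarith
  · have h2 : y ≤ D := by
      refine abs_le_of_sq_le_sq' ?_ hD.le |>.2
      nlinarith [mul_nonneg hw.le hx]
    refine le_of_mul_le_mul_right ?_ (by linarith : 0 < y + D)
    have h3 : 2 * y * x ≤ x / y * D * (y + D) := by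
      have : x / y * y * (y + y) ≤ x / y * D * (y + D) := by gcongr
      rw [div_mul_cancel₀ _ hy.ne'] at this
      linarith
    rw [hN]
    nlinarith [mul_nonneg (sub_nonneg.2 h1) hy.le, mul_nonneg (sub_nonneg.2 h1) hD.le,
      mul_pos hw hD]

/-- With `δ² = y² - 3x²` one has `D² = 4/3 (w + 3x/2)² + δ²`, so `D` dominates `w + 3x/2` and `δ`.
The bound on `|N|` splits as `4/3 (w + 3x/2) - 4x`, and `δ ≤ D` absorbs `-4x`. -/
theorem abs_le_mul_of_re_neg {x y w D N : ℝ} (hx : x ≤ 0) (hy : 0 ≤ y) (hw : 0 < w) (hD : 0 < D)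
    (hxy : 3 * x ^ 2 < y ^ 2) (hD2 : D ^ 2 = y ^ 2 + 4 * w * (x + w / 3))
    (hN : N * (y + D) = 2 / 3 * w * (y + D) + 2 * y * (x + w / 3)) :
    |N| ≤ (4 / 3 - 4 * x / √(y ^ 2 - 3 * x ^ 2)) * D := by
  have h1 : w + 3 / 2 * x ≤ D := by
    refine abs_le_of_sq_le_sq' ?_ hD.le |>.2
    nlinarith [sq_nonneg (w + 3 / 2 * x)]
  have hδ : 0 < √(y ^ 2 - 3 * x ^ 2) := Real.sqrt_pos.2 (by linarith)
  have h2 : √(y ^ 2 - 3 * x ^ 2) ≤ D := by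
    refine Real.sqrt_le_iff.2 ⟨hD.le, ?_⟩
    nlinarith [sq_nonneg (w + 3 / 2 * x)]
  have h3 : |N| ≤ 4 / 3 * w - 2 * x := by
    rw [abs_le]
    constructor <;> refine le_of_mul_le_mul_right ?_ (by linarith : 0 < y + D) <;>
      rw [hN] <;>
      nlinarith [mul_nonneg hy (neg_nonneg.2 hx), mul_nonneg hD.le (neg_nonneg.2 hx),
        mul_pos hw hD, mul_nonneg hw.le hy]
  have h4 : -4 * x ≤ -4 * x / √(y ^ 2 - 3 * x ^ 2) * D := by
    rw [div_mul_eq_mul_div, le_div_iff₀ hδ]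
    exact mul_le_mul_of_nonneg_left h2 (by linarith)
  have h5 : (4 / 3 - 4 * x / √(y ^ 2 - 3 * x ^ 2)) * D
      = 4 / 3 * D + -4 * x / √(y ^ 2 - 3 * x ^ 2) * D := by ring
  rw [h5]
  linarith

/-- On the ray `y = -√3 x` the discriminant is a perfect square, `D = √3 |2w/3 + x|`, and `N`
contains the same factor `2w/3 + x`. The two signs are the two sides of the corner; the slope is at
most `√3` on one and equal to `-1/√3` on the other. -/
theorem abs_le_mul_of_critical {x w D N : ℝ} (hx : x ≤ 0) (hw : 0 < w) (hD : 0 < D)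
    (hD2 : D ^ 2 = (-√3 * x) ^ 2 + 4 * w * (x + w / 3))
    (hN : N * (-√3 * x + D) = 2 / 3 * w * (-√3 * x + D) + 2 * (-√3 * x) * (x + w / 3)) :
    |N| ≤ 2 * D := by
  have h3 : √3 ^ 2 = 3 := Real.sq_sqrt (by norm_num)
  have hk : 0 < √3 := Real.sqrt_pos.2 (by norm_num)
  have hk1 : 1 ≤ √3 := by nlinarith
  have hk2 : √3 ≤ 2 := by nlinarith
  have hf : (√3 * D - (2 * w + 3 * x)) * (√3 * D + (2 * w + 3 * x)) = 0 := by
    linear_combination 3 * hD2 + (D ^ 2 + 3 * x ^ 2) * h3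
  rcases mul_eq_zero.1 hf with h | h
  · have hD' : D = √3 * (2 / 3 * w + x) := by
      refine mul_left_cancel₀ hk.ne' ?_
      linear_combination h - (2 / 3 * w + x) * h3
    have hpos : 0 < 2 / 3 * w + x := by
      by_contra! hc
      nlinarith
    have hNw : N * w = (2 / 3 * w + x) * (w - 3 * x) := by
      refine mul_left_cancel₀ (by positivity : (2 / 3 * √3) ≠ 0) ?_
      rw [hD'] at hN
      linear_combination hN
    have hN0 : 0 ≤ N := by
      refine nonneg_of_mul_nonneg_left (b := w) ?_ hw
      rw [hNw]
      exact mul_nonneg hpos.le (by linarith)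
    rw [abs_of_nonneg hN0]
    have : N ≤ 3 * (2 / 3 * w + x) := by
      refine le_of_mul_le_mul_right ?_ hw
      rw [hNw]
      nlinarith
    nlinarith
  · have hD' : D = -(√3 * (2 / 3 * w + x)) := by
      refine mul_left_cancel₀ hk.ne' ?_
      linear_combination h + (2 / 3 * w + x) * h3
    have hpos : 0 < -(2 / 3 * w + x) := by
      by_contra! hc
      nlinarith
    have hNw : N = 2 / 3 * w + x := by
      refine mul_right_cancel₀ (by nlinarith : (-(√3 * (w / 3 + x))) ≠ 0) ?_
      rw [hD'] at hN
      linear_combination hN / 2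
    rw [hNw, abs_of_neg (by linarith)]
    nlinarith

theorem exists_abs_deriv_pathV_le {z : ℂ} (hy : 0 ≤ z.im) (hs : 0 ≤ √3 * z.re + z.im) :
    ∃ C : ℝ, ∀ u : ℝ, 0 < u → 0 < pathDisc z u → |deriv (pathV z) u| ≤ C := by
  have key : ∀ C : ℝ, (∀ u : ℝ, 0 < u → 0 < pathDisc z u →
      |u ^ 2 - pathV z u ^ 2 + z.re| ≤ C * √(pathDisc z u)) →
      ∃ C : ℝ, ∀ u : ℝ, 0 < u → 0 < pathDisc z u → |deriv (pathV z) u| ≤ C := by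
    refine fun C h => ⟨C, fun u hu hD => ?_⟩
    rw [(hasDerivAt_pathV hu hD).deriv, two_mul_mul_pathV_add z hu, abs_div,
      abs_of_pos (Real.sqrt_pos.2 hD), div_le_iff₀ (Real.sqrt_pos.2 hD)]
    exact h u hu hD
  rcases le_total 0 z.re with hx | hx
  · exact key _ fun u hu hD => abs_le_mul_of_re_nonneg hx hy (by positivity : 0 < u ^ 2)
      (Real.sqrt_pos.2 hD) (Real.sq_sqrt hD.le) (pathV_deriv_num hs hu)
  · rcases (three_mul_re_sq_le hs hx).lt_or_eq with hlt | heq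
    · exact key _ fun u hu hD => abs_le_mul_of_re_neg hx hy (by positivity : 0 < u ^ 2)
        (Real.sqrt_pos.2 hD) hlt (Real.sq_sqrt hD.le) (pathV_deriv_num hs hu)
    · have h3 : √3 ^ 2 = 3 := Real.sq_sqrt (by norm_num)
      have him : z.im = -√3 * z.re := by
        rw [← Real.sqrt_sq hy, ← heq, ← h3, ← mul_pow, Real.sqrt_sq_eq_abs, abs_of_nonpos]
        · rw [h3]; ring
        · exact mul_nonpos_of_nonneg_of_nonpos (Real.sqrt_nonneg 3) hx
      refine key 2 fun u hu hD => abs_le_mul_of_critical hx (by positivity : 0 < u ^ 2)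
        (Real.sqrt_pos.2 hD) ?_ ?_
      · rw [← him]; exact Real.sq_sqrt hD.le
      · rw [← him]; exact pathV_deriv_num hs hu

/-! ### The two ends of the path. -/

/-- The path starts at `i √x` if `z = x > 0`, and at the origin otherwise. -/
theorem tendsto_pathV_zero {z : ℂ} (hy : 0 ≤ z.im) (hs : 0 ≤ √3 * z.re + z.im) :
    Tendsto (pathV z) (𝓝[>] 0) (𝓝 (if z.im = 0 then √z.re else 0)) := by
  split_ifs with h
  · have hc : Continuous (fun u : ℝ => √(z.re + u ^ 2 / 3)) := by fun_prop
    refine ((hc.tendsto' 0 (√z.re) (by simp)).mono_left nhdsWithin_le_nhds).congr' ?_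
    filter_upwards [self_mem_nhdsWithin] with u hu
    have hu : 0 < u := hu
    rw [pathV, h, show (0 : ℝ) ^ 2 + 4 * u ^ 2 * (z.re + u ^ 2 / 3)
      = (2 * u) ^ 2 * (z.re + u ^ 2 / 3) by ring, Real.sqrt_mul (by positivity),
      Real.sqrt_sq (by positivity)]
    field_simp
    ring
  · have hy' : 0 < z.im := lt_of_le_of_ne hy (Ne.symm h)
    have hpos : ∀ u, 0 < z.im + √(pathDisc z u) := fun u => by positivity
    have hc : Continuous (fun u : ℝ => 2 * u * (z.re + u ^ 2 / 3) / (z.im + √(pathDisc z u))) := by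
      refine Continuous.div (by fun_prop) ?_ fun u => (hpos u).ne'
      unfold pathDisc
      fun_prop
    refine ((hc.tendsto' 0 0 (by simp)).mono_left nhdsWithin_le_nhds).congr' ?_
    filter_upwards [self_mem_nhdsWithin] with u hu
    rw [div_eq_iff (hpos u).ne', pathV_mul_add_sqrt hs hu]

theorem pathV_nonneg {z : ℂ} (hy : 0 ≤ z.im) (hs : 0 ≤ √3 * z.re + z.im) {u : ℝ} (hu : 0 < u)
    (h : 0 < z.re + u ^ 2 / 3) : 0 ≤ pathV z u := by
  have h1 := pathV_mul_add_sqrt hs hu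
  have h2 : 0 ≤ z.im + √(pathDisc z u) := by positivity
  by_contra! hv
  nlinarith [mul_pos hu h, mul_nonneg h2 (neg_nonneg.2 hv.le)]

/-- Places the path below the diagonal, where the estimate for vertical segments applies; `v > u`
would make the left side of `pathV_quadratic` too large. -/
theorem eventually_pathV_mem_Icc {z : ℂ} (hy : 0 ≤ z.im) (hs : 0 ≤ √3 * z.re + z.im) :
    ∀ᶠ u in atTop, pathV z u ∈ Icc 0 u := by
  filter_upwards [eventually_ge_atTop (3 * (1 + |z.re|))] with u hu
  have hu1 : 3 ≤ u := by linarith [abs_nonneg z.re]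
  have h1 : 3 * (1 + |z.re|) ≤ u ^ 2 := by nlinarith
  have hv := pathV_nonneg hy hs (by linarith : 0 < u) (by linarith [neg_abs_le z.re])
  refine ⟨hv, ?_⟩
  by_contra! hc
  have h2 := pathV_quadratic hs (by linarith : 0 < u)
  have h3 : u ^ 2 < pathV z u ^ 2 := by nlinarith
  have h4 := mul_nonneg hy hv
  have h5 := le_abs_self z.re
  nlinarith

/-! ### Lower bounds for `ψ_i` on the path and integrability. -/

/-- Eliminating `v³` by `pathV_quadratic` gives `ψ_i = v (2x/3 + 8u²/9) + y (u + v²/(3u))`, whose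
last term is nonnegative. -/
theorem mul_le_psiIm_pathV {z : ℂ} (hy : 0 ≤ z.im) (hs : 0 ≤ √3 * z.re + z.im) {u : ℝ}
    (hu : 0 < u) :
    pathV z u * (2 / 3 * z.re + 8 / 9 * u ^ 2) ≤ psiIm z u (pathV z u) := by
  have h := pathV_quadratic hs hu
  have h1 : u * psiIm z u (pathV z u) = u * (pathV z u * (2 / 3 * z.re + 8 / 9 * u ^ 2))
      + (z.im * u ^ 2 + z.im * pathV z u ^ 2 / 3) := by
    rw [psiIm_eq]
    linear_combination (-pathV z u / 3) * h
  have h2 : 0 ≤ z.im * u ^ 2 + z.im * pathV z u ^ 2 / 3 := by positivity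
  refine le_of_mul_le_mul_left ?_ hu
  linarith

/-- A crude bound for bounded `u`, where `v` may be negative. -/
theorem neg_le_psiIm_pathV {z : ℂ} (hy : 0 ≤ z.im) (hs : 0 ≤ √3 * z.re + z.im) {u : ℝ}
    (hu : 0 < u) :
    -(2 * u * (2 / 3 * |z.re| + 8 / 9 * u ^ 2)) ≤ psiIm z u (pathV z u) := by
  refine le_trans ?_ (mul_le_psiIm_pathV hy hs hu)
  have h := pathV_quadratic hs hu
  have hx := neg_abs_le z.re
  have hx' := le_abs_self z.re
  rcases le_total 0 z.re with h0 | h0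
  · have hv := pathV_nonneg hy hs hu (by positivity)
    have : 0 ≤ pathV z u * (2 / 3 * z.re + 8 / 9 * u ^ 2) := by positivity
    have : 0 ≤ 2 * u * (2 / 3 * |z.re| + 8 / 9 * u ^ 2) := by positivity
    linarith
  · have hv : |pathV z u| ≤ 2 * u := by
      rcases le_total 0 (pathV z u) with hv | hv
      · rw [abs_of_nonneg hv]
        refine abs_le_of_sq_le_sq' ?_ (by linarith) |>.2
        have : u * pathV z u ^ 2 ≤ u * u ^ 2 := by nlinarith [mul_nonneg hy hv, pow_pos hu 3]
        nlinarith [le_of_mul_le_mul_left this hu]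
      · rw [abs_of_nonpos hv]
        have h2 := pathV_mul_add_sqrt hs hu
        have h3 : 1 ≤ √3 := Real.one_le_sqrt.2 (by norm_num)
        -- If `v < -2u`, then `v y ≥ v (y + √D) = 2u (x + u²/3) > -2u y`, a contradiction.
        have hxy : -z.re ≤ z.im := by nlinarith
        by_contra! hc
        have h4 : 0 ≤ -pathV z u * √(pathDisc z u) :=
          mul_nonneg (by linarith) (Real.sqrt_nonneg _)
        have hy' : 0 < z.im := by
          refine lt_of_le_of_ne hy fun h5 => ?_
          have : z.re = 0 := by linarith
          rw [← h5, this] at h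
          rw [← h5, this] at h2
          nlinarith [pow_pos hu 3]
        nlinarith [pow_pos hu 3, mul_pos (sub_pos.2 hc) hy', mul_nonneg hu.le (neg_nonneg.2 h0)]
    have h1 : |2 / 3 * z.re + 8 / 9 * u ^ 2| ≤ 2 / 3 * |z.re| + 8 / 9 * u ^ 2 := by
      refine (abs_add_le _ _).trans_eq ?_
      rw [abs_mul, abs_of_nonneg (by positivity : 0 ≤ 8 / 9 * u ^ 2),
        abs_of_pos (by norm_num : (0 : ℝ) < 2 / 3)]
    refine le_trans ?_ (neg_abs_le _)
    rw [abs_mul]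
    exact neg_le_neg (mul_le_mul hv h1 (abs_nonneg _) (by linarith))

theorem le_psiIm_pathV {z : ℂ} (hy : 0 ≤ z.im) (hs : 0 ≤ √3 * z.re + z.im) {u : ℝ}
    (hu : 3 * (1 + |z.re| + z.im) ≤ u) : u ≤ psiIm z u (pathV z u) := by
  have hx := neg_abs_le z.re
  have hx0 := abs_nonneg z.re
  have hu3 : 3 ≤ u := by linarith
  have hu0 : 0 < u := by linarith
  have h1 : u * (1 + |z.re| + z.im) ≤ u ^ 2 / 3 := by nlinarith
  have h2 : 3 * (1 + |z.re| + z.im) ≤ u * (1 + |z.re| + z.im) := by nlinarith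
  have hv := pathV_nonneg hy hs hu0 (by linarith)
  have hv1 : 1 ≤ pathV z u := by
    by_contra! hc
    have h := pathV_quadratic hs hu0
    have h3 : pathV z u ^ 2 ≤ 1 := by nlinarith
    nlinarith [mul_nonneg hy hv, mul_nonneg hy (sub_nonneg.2 hc.le)]
  have h4 : u ≤ 2 / 3 * z.re + 8 / 9 * u ^ 2 := by nlinarith
  refine h4.trans (le_trans ?_ (mul_le_psiIm_pathV hy hs hu0))
  exact le_mul_of_one_le_left (by linarith) hv1

theorem exists_exp_neg_psiIm_le {z : ℂ} (hy : 0 ≤ z.im) (hs : 0 ≤ √3 * z.re + z.im) :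
    ∃ K : ℝ, ∀ u : ℝ, 0 < u → Real.exp (-psiIm z u (pathV z u)) ≤ K * Real.exp (-u) := by
  set U := 3 * (1 + |z.re| + z.im) with hU
  have hU0 : 0 ≤ U := by positivity
  -- The first summand is the crude bound at `u = U`; the second absorbs `exp (-u)` for `u ≤ U`.
  refine ⟨Real.exp (2 * U * (2 / 3 * |z.re| + 8 / 9 * U ^ 2) + U), fun u hu => ?_⟩
  rw [← Real.exp_add]
  refine Real.exp_le_exp.2 ?_
  rcases le_total U u with h | h
  · have := le_psiIm_pathV hy hs h
    have : 0 ≤ 2 * U * (2 / 3 * |z.re| + 8 / 9 * U ^ 2) := by positivity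
    linarith
  · have h1 := neg_le_psiIm_pathV hy hs hu
    have h2 : 2 * u * (2 / 3 * |z.re| + 8 / 9 * u ^ 2)
        ≤ 2 * U * (2 / 3 * |z.re| + 8 / 9 * U ^ 2) := by gcongr
    linarith

/-- The only possible points of the path where it is not smooth. -/
theorem countable_pathDisc_eq_zero {z : ℂ} (hs : 0 ≤ √3 * z.re + z.im) :
    {u : ℝ | 0 < u ∧ ¬ 0 < pathDisc z u}.Countable := by
  refine (Set.Subsingleton.finite ?_).countable
  have key : ∀ u : ℝ, 0 < u ∧ ¬ 0 < pathDisc z u → 2 * u ^ 2 = -3 * z.re := by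
    rintro u ⟨hu, h⟩
    by_contra hc
    exact h (pathDisc_pos hs hu fun h' => hc h'.2)
  intro u hu w hw
  have h1 := key u hu
  have h2 := key w hw
  exact (pow_left_inj₀ hu.1.le hw.1.le two_ne_zero).1 (by linarith)

theorem integrableOn_exp_neg_psiIm_mul_pathG {z : ℂ} (hy : 0 ≤ z.im)
    (hs : 0 ≤ √3 * z.re + z.im) :
    IntegrableOn (fun u : ℝ => (Real.exp (-psiIm z u (pathV z u)) : ℂ) * pathG z u) (Ioi 0) := by
  obtain ⟨C, hC⟩ := exists_abs_deriv_pathV_le hy hs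
  obtain ⟨K, hK⟩ := exists_exp_neg_psiIm_le hy hs
  have hmV : Measurable (pathV z) := by unfold pathV; fun_prop
  have hm : Measurable (fun u : ℝ => (Real.exp (-psiIm z u (pathV z u)) : ℂ) * pathG z u) := by
    simp_rw [psiIm_eq]
    unfold pathG
    have := measurable_deriv (pathV z)
    fun_prop
  refine Integrable.mono' (g := fun u => K * Real.exp (-u) * (1 + C))
    (((integrableOn_exp_neg_Ioi 0).const_mul K).mul_const _) hm.aestronglyMeasurable ?_
  rw [ae_restrict_iff' measurableSet_Ioi]
  filter_upwards [(countable_pathDisc_eq_zero hs).ae_notMem volume] with u hu hu0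
  have hD : 0 < pathDisc z u := by
    by_contra h
    exact hu ⟨hu0, h⟩
  have h1 := hC u hu0 hD
  have h2 := hK u hu0
  rw [norm_mul, Complex.norm_real, Real.norm_of_nonneg (Real.exp_nonneg _)]
  refine mul_le_mul h2 ?_ (norm_nonneg _) ((Real.exp_nonneg _).trans h2)
  refine (norm_add_le _ _).trans ?_
  rw [norm_mul, Complex.norm_I, one_mul, norm_one, Complex.norm_real, Real.norm_eq_abs]
  linarith

/-! ### Contour deformation through a primitive of `exp (iψ)`. -/

/-- The modulus of the integrand. -/
theorem norm_exp_I_mul_psi (z : ℂ) (u v : ℝ) :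
    ‖Complex.exp (Complex.I * psi z ((u : ℂ) + v * Complex.I))‖ = Real.exp (-psiIm z u v) := by
  rw [Complex.norm_exp, Complex.I_mul_re, psiIm]

theorem exp_I_mul_psi_of_psiRe_eq_zero {z : ℂ} {u v : ℝ} (h : psiRe z u v = 0) :
    Complex.exp (Complex.I * psi z ((u : ℂ) + v * Complex.I)) = (Real.exp (-psiIm z u v) : ℂ) := by
  rw [Complex.ofReal_exp]
  congr 1
  apply Complex.ext
  · simp [psiIm]
  · rw [psiRe] at h
    simp [h]

section Primitive

variable {z : ℂ} {Φ : ℂ → ℂ}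

/-- Vertical segments: the increment of a primitive of `exp (i ψ)` is small far to the right. -/
theorem norm_primitive_vertical_le (hΦ : ∀ t, HasDerivAt Φ (Complex.exp (Complex.I * psi z t)) t)
    (hy : 0 ≤ z.im) {u v : ℝ} (hv : v ∈ Icc 0 u) (hm : 0 < 2 / 3 * u ^ 2 + z.re) :
    ‖Φ ((u : ℂ) + v * Complex.I) - Φ u‖ ≤ (2 / 3 * u ^ 2 + z.re)⁻¹ := by
  set m := 2 / 3 * u ^ 2 + z.re with hmdef
  have hd : ∀ s : ℝ, HasDerivAt (fun s : ℝ => Φ ((u : ℂ) + s * Complex.I))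
      (Complex.exp (Complex.I * psi z ((u : ℂ) + s * Complex.I)) * Complex.I) s := by
    intro s
    have h1 : HasDerivAt (fun s : ℝ => (u : ℂ) + s * Complex.I) Complex.I s := by
      simpa using (((hasDerivAt_id s).ofReal_comp).mul_const Complex.I).const_add (u : ℂ)
    exact (hΦ _).comp s h1
  have hc : Continuous fun s : ℝ =>
      Complex.exp (Complex.I * psi z ((u : ℂ) + s * Complex.I)) * Complex.I := by
    unfold psi; fun_prop
  have hb : ∀ s : ℝ, HasDerivAt (fun s : ℝ => -(Real.exp (-(m * s)) / m)) (Real.exp (-(m * s))) s := by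
    intro s
    have h1 : HasDerivAt (fun s : ℝ => -(m * s)) (-m) s := by
      simpa only [id, neg_mul, mul_one] using (hasDerivAt_id s).const_mul (-m)
    refine ((h1.exp.div_const m).neg).congr_deriv ?_
    field_simp
  have hI := intervalIntegral.integral_eq_sub_of_hasDerivAt (fun s _ => hd s)
    (hc.intervalIntegrable 0 v)
  have hJ := intervalIntegral.integral_eq_sub_of_hasDerivAt (fun s _ => hb s)
    ((by fun_prop : Continuous fun s : ℝ => Real.exp (-(m * s))).intervalIntegrable 0 v)
  simp only [Complex.ofReal_zero, zero_mul, add_zero] at hI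
  rw [← hI]
  refine (intervalIntegral.norm_integral_le_of_norm_le (g := fun s => Real.exp (-(m * s))) hv.1
    (Eventually.of_forall fun s hs => ?_)
    ((by fun_prop : Continuous fun s : ℝ => Real.exp (-(m * s))).intervalIntegrable 0 v)).trans ?_
  · rw [norm_mul, Complex.norm_I, mul_one, norm_exp_I_mul_psi]
    refine Real.exp_le_exp.2 (neg_le_neg ?_)
    have h1 : s ≤ u := hs.2.trans hv.2
    -- For `0 ≤ s ≤ u`, `ψ_i ≥ s (x + u² - s²/3) ≥ m s`, and `exp (-m s)` has integral at most
    -- `1/m`.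
    have h2 : s ^ 2 ≤ u ^ 2 := pow_le_pow_left₀ hs.1.le h1 2
    have h3 : 0 ≤ z.im * u := mul_nonneg hy (hs.1.le.trans h1)
    rw [psiIm_eq, hmdef]
    nlinarith [mul_nonneg hs.1.le (sub_nonneg.2 h2)]
  · rw [hJ]
    have : 0 ≤ Real.exp (-(m * v)) / m := by positivity
    simp only [mul_zero, neg_zero, Real.exp_zero]
    rw [inv_eq_one_div]
    linarith

theorem tendsto_primitive_vertical
    (hΦ : ∀ t, HasDerivAt Φ (Complex.exp (Complex.I * psi z t)) t) (hy : 0 ≤ z.im) {v : ℝ → ℝ}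
    (hv : ∀ᶠ u in atTop, v u ∈ Icc 0 u) :
    Tendsto (fun u : ℝ => Φ ((u : ℂ) + v u * Complex.I) - Φ u) atTop (𝓝 0) := by
  have hm : Tendsto (fun u : ℝ => 2 / 3 * u ^ 2 + z.re) atTop atTop :=
    tendsto_atTop_add_const_right _ _
      ((tendsto_pow_atTop two_ne_zero).const_mul_atTop (by norm_num))
  refine squeeze_zero_norm' ?_ (tendsto_inv_atTop_zero.comp hm)
  filter_upwards [hv, hm.eventually_gt_atTop 0] with u h1 h2
  exact norm_primitive_vertical_le hΦ hy h1 h2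

theorem tendsto_primitive_of_tendsto
    (hΦ : ∀ t, HasDerivAt Φ (Complex.exp (Complex.I * psi z t)) t) (hy : 0 ≤ z.im) {v w : ℝ → ℝ}
    (hv : ∀ᶠ u in atTop, v u ∈ Icc 0 u) (hw : ∀ᶠ u in atTop, w u ∈ Icc 0 u) {l : ℂ}
    (h : Tendsto (fun u : ℝ => Φ ((u : ℂ) + v u * Complex.I)) atTop (𝓝 l)) :
    Tendsto (fun u : ℝ => Φ ((u : ℂ) + w u * Complex.I)) atTop (𝓝 l) := by
  have h1 := (h.sub (tendsto_primitive_vertical hΦ hy hv)).add (tendsto_primitive_vertical hΦ hy hw)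
  simpa using h1

theorem integral_pathG_eq (hΦ : ∀ t, HasDerivAt Φ (Complex.exp (Complex.I * psi z t)) t)
    (hy : 0 ≤ z.im) (hs : 0 ≤ √3 * z.re + z.im) {l : ℂ}
    (h : Tendsto (fun u : ℝ => Φ ((u : ℂ) + u * Complex.I)) atTop (𝓝 l)) :
    ∫ u in Ioi (0 : ℝ), (Real.exp (-psiIm z u (pathV z u)) : ℂ) * pathG z u
      = l - Φ ((if z.im = 0 then √z.re else 0 : ℝ) * Complex.I) := by
  have hΦc : Continuous Φ := continuous_iff_continuousAt.2 fun t => (hΦ t).continuousAt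
  refine integral_Ioi_of_hasDerivAt_off_countable
    (f := fun u : ℝ => Φ ((u : ℂ) + pathV z u * Complex.I))
    (countable_pathDisc_eq_zero hs) ?_ ?_ (integrableOn_exp_neg_psiIm_mul_pathG hy hs) ?_ ?_
  · refine hΦc.comp_continuousOn ?_
    have := continuousOn_pathV z
    have h1 : ContinuousOn (fun u : ℝ => ((pathV z u : ℝ) : ℂ)) (Ioi 0) :=
      Complex.continuous_ofReal.comp_continuousOn this
    fun_prop
  · rintro u ⟨hu, hD⟩
    have hu : 0 < u := hu
    have hD : 0 < pathDisc z u := by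
      by_contra hc
      exact hD ⟨hu, hc⟩
    rw [← exp_I_mul_psi_of_psiRe_eq_zero (psiRe_pathV hs hu)]
    have h1 : HasDerivAt (fun u : ℝ => (u : ℂ) + pathV z u * Complex.I) (pathG z u) u := by
      have h2 := (hasDerivAt_pathV hu hD).differentiableAt.hasDerivAt.ofReal_comp
      have h3 := ((hasDerivAt_id u).ofReal_comp).add (h2.mul_const Complex.I)
      refine h3.congr_deriv ?_
      rw [pathG]
      push_cast
      ring
    exact (hΦ _).comp u h1
  · have h1 : Tendsto (fun u : ℝ => (u : ℂ)) (𝓝[>] 0) (𝓝 0) :=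
      (Complex.continuous_ofReal.tendsto' 0 0 (by simp)).mono_left nhdsWithin_le_nhds
    have h2 := (Complex.continuous_ofReal.tendsto _).comp (tendsto_pathV_zero hy hs)
    have h3 := h1.add (h2.mul_const Complex.I)
    rw [zero_add] at h3
    exact (hΦc.tendsto _).comp h3
  · refine tendsto_primitive_of_tendsto hΦ hy ?_ (eventually_pathV_mem_Icc hy hs) h
    filter_upwards [eventually_ge_atTop 0] with u hu
    exact ⟨hu, le_rfl⟩

end Primitive

/-! ### The diagonal ray and `Ai + i Gi`. -/

/-- The integral of `exp (i ψ)` along the ray `ph t = π / 4`. -/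
noncomputable def rayIntegral (z : ℂ) : ℂ :=
  ∫ u in Ioi (0 : ℝ), Complex.exp (Complex.I * psi z ((u : ℂ) + u * Complex.I))

theorem integrableOn_exp_ray (R : ℝ) :
    IntegrableOn (fun u : ℝ => Real.exp (R * ‖(u : ℂ) + u * Complex.I‖
      - (((u : ℂ) + u * Complex.I) ^ 3).im / 3)) (Ioi 0) := by
  set c := 2 * |R| + 1 with hc
  have hc1 : 1 ≤ c := by linarith [abs_nonneg R]
  refine Integrable.mono' (g := fun u => Real.exp (4 / 3 * c ^ 3) * Real.exp (-u))
    ((integrableOn_exp_neg_Ioi 0).const_mul _) (by fun_prop) ?_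
  rw [ae_restrict_iff' measurableSet_Ioi]
  refine Eventually.of_forall fun u hu => ?_
  have hu : 0 < u := hu
  rw [Real.norm_of_nonneg (Real.exp_nonneg _), ← Real.exp_add]
  refine Real.exp_le_exp.2 ?_
  have him : (((u : ℂ) + u * Complex.I) ^ 3).im = 2 * u ^ 3 := by
    simp [pow_succ]; ring
  have hn : ‖(u : ℂ) + u * Complex.I‖ ≤ 2 * u := by
    refine (norm_add_le _ _).trans_eq ?_
    rw [norm_mul, Complex.norm_I, Complex.norm_real, Real.norm_of_nonneg hu.le]
    ring
  have h1 : R * ‖(u : ℂ) + u * Complex.I‖ ≤ |R| * (2 * u) :=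
    (mul_le_mul_of_nonneg_right (le_abs_self R) (norm_nonneg _)).trans
      (mul_le_mul_of_nonneg_left hn (abs_nonneg R))
  -- This is the tangent bound `u³ ≥ 3c²u - 2c³`; the cubic decay then beats `2|R|u = (c - 1)u` and
  -- leaves `-u`.
  have h2 : 0 ≤ (u - c) ^ 2 * (u + 2 * c) := by positivity
  have h3 : c * u ≤ c ^ 2 * u := by nlinarith [mul_nonneg hu.le (sub_nonneg.2 hc1)]
  rw [him]
  nlinarith

theorem differentiable_rayIntegral : Differentiable ℂ rayIntegral :=
  differentiable_integral_exp_psi (γ := fun u : ℝ => (u : ℂ) + u * Complex.I) (by fun_prop)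
    integrableOn_exp_ray

theorem integrableOn_ray (z : ℂ) : IntegrableOn
    (fun u : ℝ => Complex.exp (Complex.I * psi z ((u : ℂ) + u * Complex.I))) (Ioi 0) := by
  refine (integrableOn_exp_ray ‖z‖).mono'
    (by unfold psi; fun_prop) (Eventually.of_forall fun u => ?_)
  rw [Complex.norm_exp]
  refine Real.exp_le_exp.2 ?_
  have h3 : (3 : ℂ) = ((3 : ℝ) : ℂ) := by norm_num
  have h2 := (abs_le.1 (Complex.abs_im_le_norm (z * ((u : ℂ) + u * Complex.I)))).1
  rw [norm_mul] at h2
  rw [Complex.I_mul_re, psi, Complex.add_im, h3, Complex.div_ofReal_im]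
  linarith

theorem exists_primitive_exp_I_mul_psi (z : ℂ) : ∃ Φ : ℂ → ℂ, Φ 0 = 0 ∧
    ∀ t, HasDerivAt Φ (Complex.exp (Complex.I * psi z t)) t := by
  have hd : Differentiable ℂ (fun t => Complex.exp (Complex.I * psi z t)) := by
    unfold psi; fun_prop
  obtain ⟨Φ, h0, hΦ⟩ := hd.isExactOn_univ.with_val_at 0 0
  exact ⟨Φ, h0, fun t => hΦ t (mem_univ t)⟩

theorem tendsto_primitive_ray {z : ℂ} {Φ : ℂ → ℂ} (h0 : Φ 0 = 0)
    (hΦ : ∀ t, HasDerivAt Φ (Complex.exp (Complex.I * psi z t)) t) :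
    Tendsto (fun u : ℝ => Φ ((u : ℂ) + u * Complex.I)) atTop
      (𝓝 ((1 + Complex.I) * rayIntegral z)) := by
  have h := (intervalIntegral_tendsto_integral_Ioi 0 (integrableOn_ray z) tendsto_id).const_mul
    (1 + Complex.I)
  refine h.congr fun T => ?_
  have hd : ∀ u : ℝ, HasDerivAt (fun u : ℝ => Φ ((u : ℂ) + u * Complex.I))
      ((1 + Complex.I) * Complex.exp (Complex.I * psi z ((u : ℂ) + u * Complex.I))) u := by
    intro u
    have h1 : HasDerivAt (fun u : ℝ => (u : ℂ) + u * Complex.I) (1 + Complex.I) u := by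
      have h2 := (hasDerivAt_id u).ofReal_comp
      exact (h2.add (h2.mul_const Complex.I)).congr_deriv (by simp)
    rw [mul_comm (1 + Complex.I)]
    exact (hΦ _).comp u h1
  have hc : Continuous fun u : ℝ =>
      (1 + Complex.I) * Complex.exp (Complex.I * psi z ((u : ℂ) + u * Complex.I)) := by
    unfold psi; fun_prop
  rw [← intervalIntegral.integral_const_mul,
    intervalIntegral.integral_eq_sub_of_hasDerivAt (fun u _ => hd u) (hc.intervalIntegrable _ _)]
  simp [h0]

/-- `π (Ai + i Gi)` is the integral of `exp (i ψ)` from the origin to infinity. -/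
theorem airyAi_add_I_mul_scorerGi (z : ℂ) :
    airyAi z + Complex.I * scorerGi z = 1 / Real.pi * ((1 + Complex.I) * rayIntegral z) := by
  refine congrFun (entire_eq_of_eq_on_real (f := fun z => airyAi z + Complex.I * scorerGi z)
    (g := fun z => 1 / Real.pi * ((1 + Complex.I) * rayIntegral z))
    (isAiryAi_airyAi.1.add (isScorerGi_scorerGi.1.const_mul _))
    ((differentiable_rayIntegral.const_mul _).const_mul _) fun x => ?_) z
  obtain ⟨Φ, h0, hΦ⟩ := exists_primitive_exp_I_mul_psi x
  have hlim : Tendsto (fun u : ℝ => Φ ((u : ℂ) + (0 : ℝ) * Complex.I)) atTop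
      (𝓝 ((1 + Complex.I) * rayIntegral x)) := by
    refine tendsto_primitive_of_tendsto hΦ (by simp) (v := fun u => u) (w := fun _ => 0) ?_ ?_
      (tendsto_primitive_ray h0 hΦ)
    · filter_upwards [eventually_ge_atTop 0] with u hu using ⟨hu, le_rfl⟩
    · filter_upwards [eventually_ge_atTop 0] with u hu using ⟨le_rfl, hu⟩
  refine tendsto_nhds_unique ((isAiryAi_airyAi.2 x).add ((isScorerGi_scorerGi.2 x).const_mul _))
    ((hlim.const_mul (1 / (Real.pi : ℂ))).congr fun T => ?_)
  have hd : ∀ u : ℝ, HasDerivAt (fun u : ℝ => Φ u)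
      (Complex.exp (Complex.I * psi x u)) u := fun u => (hΦ u).comp_ofReal
  have hc : Continuous fun u : ℝ => Complex.exp (Complex.I * psi x u) := by
    unfold psi; fun_prop
  have hI := intervalIntegral.integral_eq_sub_of_hasDerivAt (fun u _ => hd u)
    (hc.intervalIntegrable 0 T)
  simp_rw [exp_psi_real] at hI
  rw [intervalIntegral.integral_add (Continuous.intervalIntegrable (by fun_prop) _ _)
    (Continuous.intervalIntegrable (by fun_prop) _ _), intervalIntegral.integral_mul_const,
    intervalIntegral.integral_ofReal, intervalIntegral.integral_ofReal, Complex.ofReal_zero, h0,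
    sub_zero] at hI
  simp only [Complex.ofReal_zero, zero_mul, add_zero]
  rw [← hI]
  push_cast
  ring

theorem scorerGi_eq (z : ℂ) : scorerGi z
    = 1 / (Real.pi * Complex.I) * ((1 + Complex.I) * rayIntegral z) + Complex.I * airyAi z := by
  have h := airyAi_add_I_mul_scorerGi z
  have hI : (1 : ℂ) / (Real.pi * Complex.I) = -Complex.I * (1 / Real.pi) := by
    rw [one_div, mul_inv, Complex.inv_I, one_div, mul_comm]
  rw [hI, mul_assoc, ← h]
  linear_combination scorerGi z * Complex.I_mul_I

/-- For `y = 0` the imaginary axis also satisfies `ψ_r = 0`. With `a = √x` this supplies the value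
of `Φ` at the start of the path. -/
theorem integral_segment_eq {z : ℂ} {Φ : ℂ → ℂ} (h0 : Φ 0 = 0)
    (hΦ : ∀ t, HasDerivAt Φ (Complex.exp (Complex.I * psi z t)) t) (hy : z.im = 0) (a : ℝ) :
    ∫ v in (0 : ℝ)..a, (Real.exp (-psiIm z 0 v) : ℂ) * Complex.I = Φ (a * Complex.I) := by
  have hd : ∀ v : ℝ, HasDerivAt (fun v : ℝ => Φ (v * Complex.I))
      ((Real.exp (-psiIm z 0 v) : ℂ) * Complex.I) v := by
    intro v
    have h1 : HasDerivAt (fun v : ℝ => (v : ℂ) * Complex.I) Complex.I v := by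
      simpa using ((hasDerivAt_id v).ofReal_comp).mul_const Complex.I
    rw [← exp_I_mul_psi_of_psiRe_eq_zero (by rw [psiRe_eq, hy]; ring)]
    simpa [Function.comp_def] using (hΦ _).comp v h1
  have hc : Continuous fun v : ℝ => (Real.exp (-psiIm z 0 v) : ℂ) * Complex.I := by
    simp_rw [psiIm_eq]; fun_prop
  rw [intervalIntegral.integral_eq_sub_of_hasDerivAt (fun v _ => hd v) (hc.intervalIntegrable _ _)]
  simp [h0]

/-! ### The sector in Cartesian form and the conclusion. -/

theorem sqrt_three_mul_re_add_im (z : ℂ) :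
    √3 * z.re + z.im = 2 * ‖z‖ * Real.sin (2 * Real.pi / 3 - z.arg) := by
  have h1 : Real.sin (2 * Real.pi / 3) = √3 / 2 := by
    rw [show 2 * Real.pi / 3 = Real.pi - Real.pi / 3 by ring, Real.sin_pi_sub,
      Real.sin_pi_div_three]
  have h2 : Real.cos (2 * Real.pi / 3) = -(1 / 2) := by
    rw [show 2 * Real.pi / 3 = Real.pi - Real.pi / 3 by ring, Real.cos_pi_sub,
      Real.cos_pi_div_three]
  rw [Real.sin_sub, h1, h2]
  linear_combination (-√3) * Complex.norm_mul_cos_arg z - Complex.norm_mul_sin_arg z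

theorem sqrt_three_mul_re_add_im_nonneg {z : ℂ} (h0 : 0 ≤ z.arg) (h1 : z.arg ≤ 2 * Real.pi / 3) :
    0 ≤ √3 * z.re + z.im := by
  rw [sqrt_three_mul_re_add_im]
  have := Real.sin_nonneg_of_nonneg_of_le_pi (x := 2 * Real.pi / 3 - z.arg) (by linarith)
    (by linarith [Real.pi_pos])
  positivity

theorem arg_eq_of_sqrt_three_mul_re_add_im_eq_zero {z : ℂ} (hz : z ≠ 0) (h0 : 0 ≤ z.arg)
    (h1 : z.arg ≤ 2 * Real.pi / 3) (h : √3 * z.re + z.im = 0) : z.arg = 2 * Real.pi / 3 := by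
  by_contra hne
  have hlt := lt_of_le_of_ne h1 hne
  have := Real.sin_pos_of_pos_of_lt_pi (x := 2 * Real.pi / 3 - z.arg) (by linarith)
    (by linarith [Real.pi_pos])
  rw [sqrt_three_mul_re_add_im] at h
  have : 0 < 2 * ‖z‖ * Real.sin (2 * Real.pi / 3 - z.arg) := by positivity
  linarith

theorem mainTheorem2 (z : ℂ) (h0 : 0 ≤ z.arg) (h1 : z.arg ≤ 2 * Real.pi / 3) :
    (∀ u : ℝ, 0 < u →
      0 ≤ z.im ^ 2 + 4 * u ^ 2 * (z.re + u ^ 2 / 3) ∧ psiRe z u (pathV z u) = 0) ∧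
    (∀ u : ℝ, 0 < u → ¬ (z.arg = 2 * Real.pi / 3 ∧ 2 * u ^ 2 = -3 * z.re) →
      0 < 2 * u * pathV z u + z.im ∧
      HasDerivAt (pathV z)
        ((u ^ 2 - pathV z u ^ 2 + z.re) / (2 * u * pathV z u + z.im)) u) ∧
    IntegrableOn (fun u : ℝ => (Real.exp (-psiIm z u (pathV z u)) : ℂ) * pathG z u) (Ioi 0) ∧
    ((0 < z.arg ∨ z = 0) →
      scorerGi z = 1 / (Real.pi * Complex.I) *
          (∫ u in Ioi (0 : ℝ), (Real.exp (-psiIm z u (pathV z u)) : ℂ) * pathG z u)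
        + Complex.I * airyAi z) ∧
    ((z.arg = 0 ∧ z ≠ 0) →
      scorerGi z = 1 / (Real.pi * Complex.I) *
          ((∫ v in (0 : ℝ)..Real.sqrt z.re, (Real.exp (-psiIm z 0 v) : ℂ) * Complex.I)
            + ∫ u in Ioi (0 : ℝ), (Real.exp (-psiIm z u (pathV z u)) : ℂ) * pathG z u)
        + Complex.I * airyAi z) := by
  have hy : 0 ≤ z.im := Complex.arg_nonneg_iff.1 h0
  have hs := sqrt_three_mul_re_add_im_nonneg h0 h1
  obtain ⟨Φ, hΦ0, hΦ⟩ := exists_primitive_exp_I_mul_psi z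
  have hint := integral_pathG_eq hΦ hy hs (tendsto_primitive_ray hΦ0 hΦ)
  refine ⟨fun u hu => ⟨pathDisc_nonneg hs u, psiRe_pathV hs hu⟩, fun u hu hne => ?_,
    integrableOn_exp_neg_psiIm_mul_pathG hy hs, fun h => ?_, fun h => ?_⟩
  · have hD : 0 < pathDisc z u := by
      refine pathDisc_pos hs hu fun h => ?_
      refine hne ⟨arg_eq_of_sqrt_three_mul_re_add_im_eq_zero ?_ h0 h1 h.1, h.2⟩
      -- At `z = 0` the boundary condition holds although `arg 0 = 0`, but `2u² = 0` contradicts `u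
      -- > 0`.
      rintro rfl
      have := h.2
      simp only [Complex.zero_re] at this
      nlinarith
    refine ⟨?_, hasDerivAt_pathV hu hD⟩
    rw [two_mul_mul_pathV_add z hu]
    exact Real.sqrt_pos.2 hD
  · have hv : (if z.im = 0 then √z.re else 0) = 0 := by
      rcases h with h | rfl
      · have hpos : 0 < z.im := by
          rw [← Complex.norm_mul_sin_arg]
          have hz : z ≠ 0 := by
            rintro rfl
            simp at h
          have := Real.sin_pos_of_pos_of_lt_pi h (by linarith [Real.pi_pos])
          positivity
        rw [if_neg hpos.ne']
      · simp
    rw [hint, hv, scorerGi_eq]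
    simp [hΦ0]
  · have him : z.im = 0 := (Complex.arg_eq_zero_iff.1 h.1).2
    rw [hint, if_pos him, integral_segment_eq hΦ0 hΦ him, scorerGi_eq, add_sub_cancel]
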